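/- **Setting.** A (continuous, decreasing) function $\psi:[0,\infty)\to[0,1]$ with $\psi(0)=1$, $\lim_{t\to\infty}\psi(t)=0$ that is strictly decreasing on $[0,\inf\{t:\psi(t)=0\}]$ is called a generator, and $\psi^{-1}(s)=\inf\{t:\psi(t)=s\}$. A function $f$ is completely monotone (c.m.) on $(0,\infty)$ if it is infinitely differentiable there and $(-1)^kf^{(k)}(t)\ge 0$ for all $k\in\mathbb{N}_0$, $t>0$; it is c.m. on $[0,\infty)$ if moreover it is continuous on $[0,\infty)$. Let $\psi_{(a_1,\theta_1)}$ and $\psi_{(a_2,\theta_2)}$, with $\theta_i\in\Theta_{a_i}\subseteq[0,\infty)$, be members of one-parameter families $a_1,a_2$ of generators that are c.m. on $[0,\infty)$. For $\beta_1,\beta_2\ge 1$ let $\widetilde\psi_i(t)=\psi_{(a_i,\theta_i)}(t^{1/\beta_i})$ be their outer power transforms, and put $$\widetilde\psi_{12}(t;V_1)=\exp\bigl[-V_1\,\widetilde\psi_1^{-1}\{\widetilde\psi_2(t)\}\bigr],\qquad \bar\psi_{12}(t)=\exp\bigl[-\psi_{(a_1,\theta_1)}^{-1}\{\psi_{(a_2,\theta_2)}(t)\}\bigr].$$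 $\mathcal{LS}^{-1}[f]$ denotes the probability distribution $\mu$ on $[0,\infty)$ with $\int e^{-tx}\,d\mu(x)=f(t)$ for all $t\ge0$. $\mathrm{S}(\alpha,\beta,\gamma,\delta;1)$, with $0<\alpha\le2$, $-1\le\beta\le1$, $\gamma\ge0$, $\delta\in\mathbb{R}$, denotes the stable law with characteristic function $\exp\{-\gamma^\alpha|t|^\alpha(1-i\beta\,\mathrm{sgn}(t)\tan\frac{\pi\alpha}{2})+i\delta t\}$ if $\alpha\ne1$ and $\exp\{-\gamma|t|(1+i\beta\frac{2}{\pi}\mathrm{sgn}(t)\log|t|)+i\delta t\}$ if $\alpha=1$ (for $\gamma=0$ this is the point mass at $\delta$). **Proposition.** Let $\beta_1=1$, $\beta_2\ge1$, and suppose that $[\psi_{(a_1,\theta_1)}^{-1}\circ\psi_{(a_2,\theta_2)}]'$ is c.m. on $(0,\infty)$. Then: 1. $[\widetilde\psi_1^{-1}\circ\widetilde\psi_2]'$ is c.m. on $(0,\infty)$, i.e. the sufficient nesting condition holds for the pair of outer power generators $(\widetilde\psi_1,\widetilde\psi_2)$. 2. For every $V_1\in(0,\infty)$, $\widetilde\psi_{12}(\,\cdot\,;V_1)$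 is c.m. on $[0,\infty)$. 3. The laws $\mathrm{S}\bigl(1/\beta_2,1,\cos^{\beta_2}(\tfrac{\pi}{2\beta_2}),\mathbf 1_{\{\beta_2=1\}};1\bigr)$ and, for every $V_1\in(0,\infty)$, $\mathcal{LS}^{-1}[(\bar\psi_{12})^{V_1}]$ exist; and if $S$ and $\breve V_{12}$ are independent random variables with these respective laws, then $$V_{12}:=S\,\breve V_{12}^{\,\beta_2}\sim\mathcal{LS}^{-1}[\widetilde\psi_{12}(\,\cdot\,;V_1)].$$ -/

import Mathlib

open MeasureTheory ProbabilityTheory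

/-- A real function is completely monotone on `(0, ∞)`: it is smooth there and its derivatives
alternate in sign. -/
def IsCMOnPos (f : ℝ → ℝ) : Prop :=
  ContDiffOn ℝ ((⊤ : ℕ∞) : WithTop ℕ∞) f (Set.Ioi 0) ∧
    ∀ (k : ℕ) (t : ℝ), 0 < t → 0 ≤ (-1 : ℝ) ^ k * iteratedDeriv k f t

/-- A real function is completely monotone on `[0, ∞)`: it is continuous on `[0, ∞)` and completely
monotone on `(0, ∞)`. The derivatives at `0` may be infinite, as for `exp (-t ^ (1 / 2))`. -/
def IsCM (f : ℝ → ℝ) : Prop :=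
  ContinuousOn f (Set.Ici 0) ∧ IsCMOnPos f

/-- An Archimedean generator `ψ : [0, ∞) → [0, 1]`, given as a function on `ℝ` of which only the
restriction to `[0, ∞)` matters. -/
structure IsGenerator (ψ : ℝ → ℝ) : Prop where
  continuousOn : ContinuousOn ψ (Set.Ici 0)
  mapsTo : Set.MapsTo ψ (Set.Ici 0) (Set.Icc 0 1)
  antitoneOn : AntitoneOn ψ (Set.Ici 0)
  /-- `ψ` is strictly decreasing on `[0, inf {u | ψ u = 0}]` (all of `[0, ∞)` if `ψ` has no zero):
  `t` lies below the infimum iff it is a lower bound of the set of zeros. -/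
  strictAntiOn : StrictAntiOn ψ {t | 0 ≤ t ∧ ∀ u, 0 ≤ u → ψ u = 0 → t ≤ u}
  map_zero : ψ 0 = 1
  tendsto_zero : Filter.Tendsto ψ Filter.atTop (nhds 0)

/-- The generalized inverse `ψ⁻¹ s = inf {t | ψ t = s}` of a generator. A completely monotone
generator maps `[0, ∞)` onto `(0, 1]`, so for `s` in `(0, 1]` the set is nonempty. (The value `∞`
at `s = 0` is not represented; a completely monotone generator never vanishes.) -/
noncomputable def genInv (ψ : ℝ → ℝ) (s : ℝ) : ℝ :=
  sInf {t : ℝ | 0 ≤ t ∧ ψ t = s}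

/-- A one-parameter family of completely monotone generators `ψ_θ`, `θ ∈ Θ ⊆ [0, ∞)`. -/
structure CMGeneratorFamily where
  Θ : Set ℝ
  Θ_subset : Θ ⊆ Set.Ici 0
  gen : ℝ → ℝ → ℝ
  isGenerator : ∀ θ ∈ Θ, IsGenerator (gen θ)
  isCM : ∀ θ ∈ Θ, IsCM (gen θ)

/-- The outer power transform `t ↦ ψ (t ^ (1 / β))`. -/
noncomputable def outerPower (ψ : ℝ → ℝ) (β : ℝ) (t : ℝ) : ℝ :=
  ψ (t ^ (1 / β))

/-- The outer power generator `ψ_(a, θ, β)`. -/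
noncomputable def CMGeneratorFamily.opGen (a : CMGeneratorFamily) (θ β : ℝ) : ℝ → ℝ :=
  outerPower (a.gen θ) β

/-- `psi12 ψ₁ ψ₂ V t = exp (-V * ψ₁⁻¹ (ψ₂ t))`. -/
noncomputable def psi12 (ψ₁ ψ₂ : ℝ → ℝ) (V : ℝ) (t : ℝ) : ℝ :=
  Real.exp (-V * genInv ψ₁ (ψ₂ t))

/-- `psiBar12 ψ₁ ψ₂ t = exp (-ψ₁⁻¹ (ψ₂ t))`. -/
noncomputable def psiBar12 (ψ₁ ψ₂ : ℝ → ℝ) (t : ℝ) : ℝ :=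
  Real.exp (-genInv ψ₁ (ψ₂ t))

/-- `μ` is the inverse Laplace-Stieltjes transform of `f`: it is a probability distribution on
`[0, ∞)` with `∫ exp (-t x) dμ(x) = f t` for all `t ≥ 0`. -/
structure IsLSInverse (f : ℝ → ℝ) (μ : Measure ℝ) : Prop where
  isProbabilityMeasure : IsProbabilityMeasure μ
  nonneg : μ (Set.Iio 0) = 0
  laplace : ∀ t : ℝ, 0 ≤ t → ∫ x, Real.exp (-t * x) ∂μ = f t

/-- The characteristic exponent of the stable law `S(α, β, γ, δ; 1)` (1-parametrization), i.e.
`-γ^α |t|^α (1 - i β sgn(t) tan(π α / 2)) + i δ t` if `α ≠ 1`, and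
`-γ |t| (1 + i β (2 / π) sgn(t) log |t|) + i δ t` if `α = 1`. -/
noncomputable def stableExponent (α β γ δ t : ℝ) : ℂ :=
  if α = 1 then
    -((γ * |t| : ℝ) : ℂ) *
        (1 + Complex.I * ((β * (2 / Real.pi) * Real.sign t * Real.log |t| : ℝ) : ℂ))
      + Complex.I * ((δ * t : ℝ) : ℂ)
  else
    -((γ ^ α * |t| ^ α : ℝ) : ℂ) *
        (1 - Complex.I * ((β * Real.sign t * Real.tan (Real.pi * α / 2) : ℝ) : ℂ))
      + Complex.I * ((δ * t : ℝ) : ℂ)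

/-- `μ` is the stable law `S(α, β, γ, δ; 1)`; the scale `γ = 0` gives the point mass at `δ`. -/
structure IsStableS1 (α β γ δ : ℝ) (μ : Measure ℝ) : Prop where
  alpha_mem : α ∈ Set.Ioc (0 : ℝ) 2
  beta_mem : β ∈ Set.Icc (-1 : ℝ) 1
  gamma_nonneg : 0 ≤ γ
  isProbabilityMeasure : IsProbabilityMeasure μ
  charFun_eq : ∀ t : ℝ, charFun μ t = Complex.exp (stableExponent α β γ δ t)

/-- The law `S(1/β, 1, cos^β(π/(2β)), 𝟙_{β = 1}; 1)`. -/
def IsOuterPowerStable (β : ℝ) (μ : Measure ℝ) : Prop :=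
  IsStableS1 (1 / β) 1 (Real.cos (Real.pi / (2 * β)) ^ β) (if β = 1 then 1 else 0) μ

/-! Put `h = ψ₁⁻¹ ∘ ψ₂`, a Bernstein function: it is positive on `(0, ∞)`, `h 0 = 0` and `h'` is
c.m. As `β₁ = 1`, outer powers merely replace `h t` by `h (t ^ (1 / β₂))`. Its derivative `h' (t ^
(1 / β₂)) * (t ^ (1 / β₂))'` is a product of c.m. functions, and `exp (-V₁ * ·)` composed with a
Bernstein function is c.m. These closure properties are proved order by order through `CMUpTo`,
where each induction needs only the product or chain rule once.

The laws exist by Bernstein's theorem `IsCM.exists_isLSInverse`: the Taylor series of a c.m.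
function at a large point `a` makes `f (a - a * exp (-t / a))` the Laplace transform of a discrete
law, and these laws are tight as `a → ∞`. The law with transform `exp (-t ^ (1 / β₂))` is identified
with the stable law by continuing the transform analytically to the imaginary axis
(`IsLSInverse.charFun_eq_of_exp_neg_rpow`).

The representation is then conditioning on `V`: `E exp (-t S V ^ β₂) = E exp (-(t V ^ β₂) ^ (1 /
β₂)) = E exp (-t ^ (1 / β₂) V)`, the transform of `V` at `t ^ (1 / β₂)` (`isLSInverse_mul_rpow`). -/

/-! ### Closure properties of complete monotonicity -/

/-- Complete monotonicity on `(0, ∞)` up to order `n`, by recursion on `n`. -/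
def CMUpTo : ℕ → (ℝ → ℝ) → Prop
  | 0, f => ∀ t, 0 < t → 0 ≤ f t
  | n + 1, f => (∀ t, 0 < t → 0 ≤ f t) ∧ DifferentiableOn ℝ f (Set.Ioi 0) ∧
      CMUpTo n fun t => -deriv f t

namespace CMUpTo

variable {n : ℕ} {f g : ℝ → ℝ}

lemma nonneg (hf : CMUpTo n f) : ∀ t, 0 < t → 0 ≤ f t := by
  cases n with
  | zero => exact hf
  | succ n => exact hf.1

lemma congr (hf : CMUpTo n f) (h : Set.EqOn f g (Set.Ioi 0)) : CMUpTo n g := by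
  induction n generalizing f g with
  | zero => exact fun t ht => h ht ▸ hf t ht
  | succ n ih =>
    refine ⟨fun t ht => h ht ▸ hf.1 t ht, hf.2.1.congr fun t ht => (h ht).symm,
      ih hf.2.2 fun t ht => ?_⟩
    have : f =ᶠ[nhds t] g := h.eventuallyEq_of_mem (Ioi_mem_nhds ht)
    simp only [this.deriv_eq]

lemma of_succ (hf : CMUpTo (n + 1) f) : CMUpTo n f := by
  induction n generalizing f with
  | zero => exact hf.1
  | succ n ih => exact ⟨hf.1, hf.2.1, ih hf.2.2⟩

lemma add (hf : CMUpTo n f) (hg : CMUpTo n g) : CMUpTo n fun t => f t + g t := by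
  induction n generalizing f g with
  | zero => exact fun t ht => add_nonneg (hf t ht) (hg t ht)
  | succ n ih =>
    refine ⟨fun t ht => add_nonneg (hf.1 t ht) (hg.1 t ht), hf.2.1.add hg.2.1,
      (ih hf.2.2 hg.2.2).congr fun t ht => ?_⟩
    have h1 := hf.2.1.differentiableAt (Ioi_mem_nhds ht)
    have h2 := hg.2.1.differentiableAt (Ioi_mem_nhds ht)
    simp only [deriv_fun_add h1 h2]
    ring

lemma mul (hf : CMUpTo n f) (hg : CMUpTo n g) : CMUpTo n fun t => f t * g t := by
  induction n generalizing f g with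
  | zero => exact fun t ht => mul_nonneg (hf t ht) (hg t ht)
  | succ n ih =>
    refine ⟨fun t ht => mul_nonneg (hf.1 t ht) (hg.1 t ht), hf.2.1.mul hg.2.1,
      ((ih hf.2.2 hg.of_succ).add (ih hf.of_succ hg.2.2)).congr fun t ht => ?_⟩
    have h1 := hf.2.1.differentiableAt (Ioi_mem_nhds ht)
    have h2 := hg.2.1.differentiableAt (Ioi_mem_nhds ht)
    simp only [deriv_fun_mul h1 h2]
    ring

lemma const {c : ℝ} (hc : 0 ≤ c) : CMUpTo n fun _ => c := by
  induction n generalizing c with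
  | zero => exact fun _ _ => hc
  | succ n ih =>
    refine ⟨fun _ _ => hc, differentiableOn_const c, ?_⟩
    simpa using ih le_rfl

/-- By the chain rule `-(f ∘ g)' = ((-f') ∘ g) * g'`, so the induction closes under `mul`, with `g'`
held fixed up to a loss of order. -/
lemma comp (hf : CMUpTo n f) (hg : ∀ t, 0 < t → 0 < g t)
    (hgd : DifferentiableOn ℝ g (Set.Ioi 0)) (hg' : CMUpTo n (deriv g)) :
    CMUpTo n fun t => f (g t) := by
  induction n generalizing f with
  | zero => exact fun t ht => hf _ (hg t ht)
  | succ n ih =>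
    refine ⟨fun t ht => hf.1 _ (hg t ht), hf.2.1.comp hgd hg,
      ((ih hf.2.2 hg'.of_succ).mul hg'.of_succ).congr fun t ht => ?_⟩
    have h1 := hf.2.1.differentiableAt (Ioi_mem_nhds (hg t ht))
    have h2 := hgd.differentiableAt (Ioi_mem_nhds ht)
    have := (h1.hasDerivAt.comp t h2.hasDerivAt).deriv
    simp only [Function.comp_def] at this
    simp only [this]
    ring

lemma rpow_neg {r : ℝ} (hr : 0 ≤ r) : CMUpTo n fun t => t ^ (-r) := by
  induction n generalizing r with
  | zero => exact fun t ht => Real.rpow_nonneg ht.le _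
  | succ n ih =>
    refine ⟨fun t ht => Real.rpow_nonneg ht.le _, fun t ht =>
      (Real.differentiableAt_rpow_const_of_ne _ (ne_of_gt ht)).differentiableWithinAt,
      ((const hr).mul (ih (r := r + 1) (by linarith))).congr fun t ht => ?_⟩
    have := (Real.hasDerivAt_rpow_const (x := t) (p := -r) (Or.inl (ne_of_gt ht))).deriv
    simp only [this]
    rw [show -(r + 1) = -r - 1 by ring]
    ring

lemma exp_neg_mul {c : ℝ} (hc : 0 ≤ c) : CMUpTo n fun t => Real.exp (-c * t) := by
  induction n with
  | zero => exact fun t _ => (Real.exp_pos _).le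
  | succ n ih =>
    refine ⟨fun t _ => (Real.exp_pos _).le, by fun_prop, ((const hc).mul ih).congr fun t _ => ?_⟩
    have : HasDerivAt (fun t => Real.exp (-c * t)) (Real.exp (-c * t) * (-c * 1)) t :=
      ((hasDerivAt_id t).const_mul (-c)).exp
    simp only [this.deriv]
    ring

lemma iteratedDeriv_nonneg (hf : CMUpTo n f) {t : ℝ} (ht : 0 < t) :
    0 ≤ (-1 : ℝ) ^ n * iteratedDeriv n f t := by
  induction n generalizing f with
  | zero => simpa using hf t ht
  | succ n ih =>
    have := ih hf.2.2
    rw [show (fun t => -deriv f t) = -deriv f from rfl, iteratedDeriv_neg] at this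
    rw [iteratedDeriv_succ', pow_succ]
    linarith

/-- One order is lost because level `0` of `CMUpTo` carries no regularity; level `1` is the first to
give continuity. -/
lemma contDiffOn (hf : CMUpTo (n + 1) f) : ContDiffOn ℝ n f (Set.Ioi 0) := by
  induction n generalizing f with
  | zero => exact contDiffOn_zero.2 hf.2.1.continuousOn
  | succ n ih =>
    have h := (ih hf.2.2).neg
    simp only [neg_neg] at h
    push_cast
    rw [contDiffOn_succ_iff_deriv_of_isOpen isOpen_Ioi]
    exact ⟨hf.2.1, by simp, h⟩

end CMUpTo

namespace IsCMOnPos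

variable {f g : ℝ → ℝ}

lemma differentiableOn (hf : IsCMOnPos f) : DifferentiableOn ℝ f (Set.Ioi 0) :=
  hf.1.differentiableOn (by simp)

lemma differentiableAt (hf : IsCMOnPos f) {t : ℝ} (ht : 0 < t) : DifferentiableAt ℝ f t :=
  hf.differentiableOn.differentiableAt (Ioi_mem_nhds ht)

lemma nonneg (hf : IsCMOnPos f) {t : ℝ} (ht : 0 < t) : 0 ≤ f t := by
  simpa using hf.2 0 t ht

lemma neg_deriv (hf : IsCMOnPos f) : IsCMOnPos fun t => -deriv f t := by
  refine ⟨((contDiffOn_infty_iff_deriv_of_isOpen isOpen_Ioi).1 hf.1).2.neg, fun k t ht => ?_⟩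
  have := hf.2 (k + 1) t ht
  rw [iteratedDeriv_succ', pow_succ] at this
  rw [show (fun t => -deriv f t) = -deriv f from rfl, iteratedDeriv_neg]
  linarith

lemma cmUpTo (hf : IsCMOnPos f) (n : ℕ) : CMUpTo n f := by
  induction n generalizing f with
  | zero => exact fun t ht => hf.nonneg ht
  | succ n ih => exact ⟨fun t ht => hf.nonneg ht, hf.differentiableOn, ih hf.neg_deriv⟩

end IsCMOnPos

lemma isCMOnPos_iff_cmUpTo {f : ℝ → ℝ} : IsCMOnPos f ↔ ∀ n, CMUpTo n f :=
  ⟨fun hf => hf.cmUpTo, fun hf => ⟨contDiffOn_infty.2 fun n => (hf (n + 1)).contDiffOn,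
    fun k _ ht => (hf k).iteratedDeriv_nonneg ht⟩⟩

namespace IsCMOnPos

variable {f g : ℝ → ℝ}

lemma congr (hf : IsCMOnPos f) (h : Set.EqOn f g (Set.Ioi 0)) : IsCMOnPos g :=
  isCMOnPos_iff_cmUpTo.2 fun n => (hf.cmUpTo n).congr h

lemma mul (hf : IsCMOnPos f) (hg : IsCMOnPos g) : IsCMOnPos fun t => f t * g t :=
  isCMOnPos_iff_cmUpTo.2 fun n => (hf.cmUpTo n).mul (hg.cmUpTo n)

lemma const {c : ℝ} (hc : 0 ≤ c) : IsCMOnPos fun _ => c :=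
  isCMOnPos_iff_cmUpTo.2 fun _ => CMUpTo.const hc

lemma rpow_neg {r : ℝ} (hr : 0 ≤ r) : IsCMOnPos fun t => t ^ (-r) :=
  isCMOnPos_iff_cmUpTo.2 fun _ => CMUpTo.rpow_neg hr

lemma exp_neg_mul {c : ℝ} (hc : 0 ≤ c) : IsCMOnPos fun t => Real.exp (-c * t) :=
  isCMOnPos_iff_cmUpTo.2 fun _ => CMUpTo.exp_neg_mul hc

/-- A completely monotone function of a Bernstein function is completely monotone. -/
lemma comp (hf : IsCMOnPos f) (hg : ∀ t, 0 < t → 0 < g t)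
    (hgd : DifferentiableOn ℝ g (Set.Ioi 0)) (hg' : IsCMOnPos (deriv g)) :
    IsCMOnPos fun t => f (g t) :=
  isCMOnPos_iff_cmUpTo.2 fun n => (hf.cmUpTo n).comp hg hgd (hg'.cmUpTo n)

lemma deriv_rpow {r : ℝ} (h0 : 0 ≤ r) (h1 : r ≤ 1) : IsCMOnPos (deriv fun t : ℝ => t ^ r) := by
  refine ((const h0).mul (rpow_neg (r := 1 - r) (by linarith))).congr fun t ht => ?_
  simp [(Real.hasDerivAt_rpow_const (x := t) (p := r) (Or.inl (ne_of_gt ht))).deriv]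

lemma antitoneOn (hf : IsCMOnPos f) : AntitoneOn f (Set.Ioi 0) := by
  refine antitoneOn_of_deriv_nonpos (convex_Ioi 0) hf.differentiableOn.continuousOn
    (hf.differentiableOn.mono interior_subset) fun t ht => ?_
  rw [interior_Ioi] at ht
  linarith [hf.neg_deriv.nonneg ht]

lemma iteratedDeriv (hf : IsCMOnPos f) (k : ℕ) :
    IsCMOnPos fun t => (-1) ^ k * iteratedDeriv k f t := by
  induction k with
  | zero => simpa using hf
  | succ k ih =>
    refine ih.neg_deriv.congr fun t _ => ?_
    simp only [deriv_const_mul_field, iteratedDeriv_succ]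
    ring

end IsCMOnPos

/-! ### Taylor series of completely monotone functions -/

namespace IsCMOnPos

variable {f : ℝ → ℝ}

/-- Expanding about the right endpoint `a` absorbs the alternating signs, so all terms are
nonnegative. Rescaling the remainder to `[0, 1]` lets remainders at different `x` be compared
pointwise. -/
lemma taylor_remainder (hf : IsCMOnPos f) {a x : ℝ} (hx : 0 < x) (hxa : x < a) (n : ℕ) :
    f x = ∑ k ∈ Finset.range (n + 1),
        (-1) ^ k * _root_.iteratedDeriv k f a / k.factorial * (a - x) ^ k +
      (a - x) ^ (n + 1) * ∫ s in (0 : ℝ)..1, s ^ n / n.factorial *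
        ((-1) ^ (n + 1) * _root_.iteratedDeriv (n + 1) f (x + (a - x) * s)) := by
  have hsub : Set.uIcc a x ⊆ Set.Ioi 0 := by
    rw [Set.uIcc_of_ge hxa.le]
    exact fun y hy => hx.trans_le hy.1
  have heq : ∀ k : ℕ, ∀ t ∈ Set.uIcc a x,
      iteratedDerivWithin k f (Set.uIcc a x) t = _root_.iteratedDeriv k f t := fun k t ht =>
    iteratedDerivWithin_eq_iteratedDeriv (uniqueDiffOn_uIcc hxa.ne')
      ((hf.1.contDiffAt (Ioi_mem_nhds (hsub ht))).of_le (by exact_mod_cast le_top)) ht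
  have h := taylor_integral_remainder (n := n)
    ((hf.1.mono hsub).of_le (by exact_mod_cast le_top))
  rw [taylor_within_apply, sub_eq_iff_eq_add, add_comm] at h
  rw [h]
  congr 1
  · refine Finset.sum_congr rfl fun k _ => ?_
    rw [heq k a Set.left_mem_uIcc, smul_eq_mul, ← neg_sub a x, neg_pow]
    field_simp
  · rw [intervalIntegral.integral_congr (g := fun t => (x - t) ^ n / n.factorial *
      _root_.iteratedDeriv (n + 1) f t) fun t ht => by simp only [heq _ t ht, smul_eq_mul]]
    have hc := intervalIntegral.integral_comp_mul_add (a := 0) (b := 1)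
      (fun t => (x - t) ^ n / n.factorial * _root_.iteratedDeriv (n + 1) f t)
      (sub_pos.2 hxa).ne' x
    simp only [mul_zero, zero_add, mul_one, sub_add_cancel, smul_eq_mul] at hc
    rw [intervalIntegral.integral_symm, eq_comm, pow_succ', mul_assoc,
      ← intervalIntegral.integral_const_mul]
    rw [eq_inv_mul_iff_mul_eq₀ (sub_pos.2 hxa).ne'] at hc
    rw [← hc, ← mul_neg, ← intervalIntegral.integral_neg]
    congr 1
    refine intervalIntegral.integral_congr fun s _ => ?_
    rw [show x - ((a - x) * s + x) = -((a - x) * s) by ring, neg_pow ((a - x) * s), mul_pow, pow_succ,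
      show (a - x) * s + x = x + (a - x) * s by ring]
    ring

lemma taylor_remainder_integrand_nonneg (hf : IsCMOnPos f) {a x : ℝ} (hx : 0 < x) (hxa : x < a)
    (n : ℕ) {s : ℝ} (hs : s ∈ Set.Icc (0 : ℝ) 1) : 0 ≤ s ^ n / n.factorial *
      ((-1) ^ (n + 1) * _root_.iteratedDeriv (n + 1) f (x + (a - x) * s)) := by
  have h0 := hs.1
  have := mul_nonneg (sub_pos.2 hxa).le hs.1
  exact mul_nonneg (by positivity) (hf.2 _ _ (by linarith))

lemma continuousOn_taylor_remainder_integrand (hf : IsCMOnPos f) {a x : ℝ} (hx : 0 < x)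
    (hxa : x < a) (n : ℕ) : ContinuousOn (fun s : ℝ => s ^ n / n.factorial *
      ((-1) ^ (n + 1) * _root_.iteratedDeriv (n + 1) f (x + (a - x) * s))) (Set.Icc 0 1) := by
  refine ContinuousOn.mul (by fun_prop) ?_
  refine (hf.iteratedDeriv (n + 1)).differentiableOn.continuousOn.comp
    (f := fun s => x + (a - x) * s) (by fun_prop) fun s hs => ?_
  have := mul_nonneg (sub_pos.2 hxa).le hs.1
  exact Set.mem_Ioi.2 (by linarith)

lemma sum_taylor_le (hf : IsCMOnPos f) {a x : ℝ} (hx : 0 < x) (hxa : x < a) (n : ℕ) :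
    ∑ k ∈ Finset.range (n + 1),
      (-1) ^ k * _root_.iteratedDeriv k f a / k.factorial * (a - x) ^ k ≤ f x := by
  rw [hf.taylor_remainder hx hxa n]
  exact le_add_of_nonneg_right (mul_nonneg (pow_nonneg (sub_pos.2 hxa).le _)
    (intervalIntegral.integral_nonneg zero_le_one fun s hs =>
      hf.taylor_remainder_integrand_nonneg hx hxa n hs))

lemma coeff_nonneg (hf : IsCMOnPos f) {a : ℝ} (ha : 0 < a) (k : ℕ) :
    0 ≤ (-1) ^ k * _root_.iteratedDeriv k f a / k.factorial :=
  div_nonneg (hf.2 k a ha) (by positivity)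

/-- The rescaled remainder integral decreases in `x`, since `(-1) ^ (n + 1)` times the derivative of
order `n + 1` is antitone. At `b` the whole remainder is at most `f b`, and only the prefactor
changes from `b` to `x`. -/
lemma sub_sum_taylor_le (hf : IsCMOnPos f) {a b x : ℝ} (hb : 0 < b) (hbx : b ≤ x) (hxa : x < a)
    (n : ℕ) : f x - ∑ k ∈ Finset.range (n + 1),
        (-1) ^ k * _root_.iteratedDeriv k f a / k.factorial * (a - x) ^ k ≤
      ((a - x) / (a - b)) ^ (n + 1) * f b := by
  have hba := hbx.trans_lt hxa
  have hx := hb.trans_le hbx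
  have hab : 0 < a - b := sub_pos.2 hba
  have hmono : (∫ s in (0 : ℝ)..1, s ^ n / n.factorial *
        ((-1) ^ (n + 1) * _root_.iteratedDeriv (n + 1) f (x + (a - x) * s))) ≤
      ∫ s in (0 : ℝ)..1, s ^ n / n.factorial *
        ((-1) ^ (n + 1) * _root_.iteratedDeriv (n + 1) f (b + (a - b) * s)) := by
    refine intervalIntegral.integral_mono_on zero_le_one
      (ContinuousOn.intervalIntegrable_of_Icc zero_le_one
        (hf.continuousOn_taylor_remainder_integrand hx hxa n))
      (ContinuousOn.intervalIntegrable_of_Icc zero_le_one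
        (hf.continuousOn_taylor_remainder_integrand hb hba n)) fun s hs => ?_
    have h0 := hs.1
    have h1 : b + (a - b) * s ≤ x + (a - x) * s := by nlinarith [hs.2]
    have h2 : 0 < b + (a - b) * s := by nlinarith [mul_nonneg hab.le h0]
    exact mul_le_mul_of_nonneg_left
      ((hf.iteratedDeriv (n + 1)).antitoneOn h2 (h2.trans_le h1) h1) (by positivity)
  have hR : (a - b) ^ (n + 1) * (∫ s in (0 : ℝ)..1, s ^ n / n.factorial *
        ((-1) ^ (n + 1) * _root_.iteratedDeriv (n + 1) f (b + (a - b) * s))) ≤ f b := by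
    conv_rhs => rw [hf.taylor_remainder hb hba n]
    exact le_add_of_nonneg_left (Finset.sum_nonneg fun k _ =>
      mul_nonneg (hf.coeff_nonneg (hb.trans hba) k) (pow_nonneg hab.le _))
  have hax : 0 < a - x := sub_pos.2 hxa
  rw [hf.taylor_remainder hx hxa n, add_sub_cancel_left]
  calc _ ≤ (a - x) ^ (n + 1) * _ := mul_le_mul_of_nonneg_left hmono (by positivity)
    _ ≤ (a - x) ^ (n + 1) * (f b / (a - b) ^ (n + 1)) := by
        refine mul_le_mul_of_nonneg_left ?_ (by positivity)
        rw [le_div_iff₀ (by positivity), mul_comm]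
        exact hR
    _ = _ := by rw [div_pow]; ring

/-- A completely monotone function is the sum of its Taylor series at `a` on `(0, a)`. -/
lemma hasSum_taylor (hf : IsCMOnPos f) {a x : ℝ} (hx : 0 < x) (hxa : x < a) :
    HasSum (fun k : ℕ => (-1) ^ k * _root_.iteratedDeriv k f a / k.factorial * (a - x) ^ k)
      (f x) := by
  have hax : 0 < a - x := sub_pos.2 hxa
  have hb : 0 < a - x / 2 := by linarith
  rw [hasSum_iff_tendsto_nat_of_nonneg fun k =>
    mul_nonneg (hf.coeff_nonneg (hx.trans hxa) k) (pow_nonneg hax.le _),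
    ← Filter.tendsto_add_atTop_iff_nat 1]
  -- The comparison point `b = x / 2` is positive and strictly below `x`, so the ratio is less than
  -- `1`.
  have hlim : Filter.Tendsto (fun n : ℕ => f x - ((a - x) / (a - x / 2)) ^ (n + 1) * f (x / 2))
      Filter.atTop (nhds (f x - 0 * f (x / 2))) :=
    (((Filter.tendsto_add_atTop_iff_nat 1).2 (tendsto_pow_atTop_nhds_zero_of_lt_one
      (by positivity) ((div_lt_one hb).2 (by linarith)))).mul_const _).const_sub _
  rw [zero_mul, sub_zero] at hlim
  refine tendsto_of_tendsto_of_tendsto_of_le_of_le hlim tendsto_const_nhds (fun n => ?_)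
    fun n => hf.sum_taylor_le hx hxa n
  have := hf.sub_sum_taylor_le (half_pos hx) (half_le_self hx.le) hxa n
  simp only
  linarith

end IsCMOnPos

lemma IsCM.antitoneOn {f : ℝ → ℝ} (hf : IsCM f) : AntitoneOn f (Set.Ici 0) := by
  refine antitoneOn_of_deriv_nonpos (convex_Ici 0) hf.1 ?_ fun t ht => ?_
  · rw [interior_Ici]
    exact hf.2.differentiableOn
  · rw [interior_Ici] at ht
    linarith [hf.2.neg_deriv.nonneg ht]

/-- Only `x = 0` is new, and derivatives may blow up there. Partial sums at `y > 0` are at most `f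
y`, which bounds those at `0` as `y → 0`; conversely the series at `0` dominates the one at `y`
termwise. -/
lemma IsCM.hasSum_taylor {f : ℝ → ℝ} (hf : IsCM f) {a x : ℝ} (hx : 0 ≤ x) (hxa : x < a) :
    HasSum (fun k : ℕ => (-1) ^ k * iteratedDeriv k f a / k.factorial * (a - x) ^ k) (f x) := by
  rcases hx.eq_or_lt with rfl | hx
  swap
  · exact hf.2.hasSum_taylor hx hxa
  have hlim : Filter.Tendsto f (nhdsWithin 0 (Set.Ioi 0)) (nhds (f 0)) :=
    (hf.1 0 Set.self_mem_Ici).mono_left (nhdsWithin_mono _ Set.Ioi_subset_Ici_self)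
  have hsmall : ∀ᶠ y in nhdsWithin (0 : ℝ) (Set.Ioi 0), y ∈ Set.Ioo 0 a :=
    Ioo_mem_nhdsGT hxa
  have hnn : ∀ k : ℕ, 0 ≤ (-1) ^ k * iteratedDeriv k f a / k.factorial * (a - 0) ^ k := fun k =>
    mul_nonneg (hf.2.coeff_nonneg hxa k) (pow_nonneg (by linarith) _)
  have hle : ∀ n : ℕ, ∑ k ∈ Finset.range n,
      (-1) ^ k * iteratedDeriv k f a / k.factorial * (a - 0) ^ k ≤ f 0 := by
    intro n
    have h1 : Filter.Tendsto (fun y => ∑ k ∈ Finset.range n,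
        (-1) ^ k * iteratedDeriv k f a / k.factorial * (a - y) ^ k)
        (nhdsWithin 0 (Set.Ioi 0)) (nhds (∑ k ∈ Finset.range n,
        (-1) ^ k * iteratedDeriv k f a / k.factorial * (a - 0) ^ k)) :=
      (Continuous.tendsto (by fun_prop) 0).mono_left nhdsWithin_le_nhds
    refine le_of_tendsto_of_tendsto h1 hlim (hsmall.mono fun y hy => ?_)
    exact sum_le_hasSum _ (fun k _ => mul_nonneg (hf.2.coeff_nonneg hxa k)
      (pow_nonneg (by linarith [hy.2]) _)) (hf.2.hasSum_taylor hy.1 hy.2)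
  have hs := summable_of_sum_range_le hnn hle
  refine (hs.hasSum_iff).2 (le_antisymm (hs.tsum_le_of_sum_range_le hle) ?_)
  refine le_of_tendsto hlim (hsmall.mono fun y hy => ?_)
  rw [← (hf.2.hasSum_taylor hy.1 hy.2).tsum_eq]
  refine (hf.2.hasSum_taylor hy.1 hy.2).summable.tsum_le_tsum (fun k => ?_) hs
  have := hf.2.coeff_nonneg hxa k
  have h1 := hy.1
  have h2 : 0 ≤ a - y := by linarith [hy.2]
  gcongr

/-! ### Laplace transforms, tightness and continuity -/

namespace IsLSInverse

variable {f : ℝ → ℝ} {μ : Measure ℝ}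

lemma ae_nonneg (h : IsLSInverse f μ) : ∀ᵐ x ∂μ, 0 ≤ x := by
  rw [ae_iff]
  simpa [Set.Iio] using h.nonneg

lemma integrable_exp (h : IsLSInverse f μ) {t : ℝ} (ht : 0 ≤ t) :
    Integrable (fun x => Real.exp (-t * x)) μ := by
  have := h.isProbabilityMeasure
  refine Integrable.of_bound (by fun_prop) 1 (h.ae_nonneg.mono fun x hx => ?_)
  rw [Real.norm_eq_abs, Real.abs_exp, Real.exp_le_one_iff]
  nlinarith

lemma pos (h : IsLSInverse f μ) {t : ℝ} (ht : 0 ≤ t) : 0 < f t := by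
  have := h.isProbabilityMeasure
  rw [← h.laplace t ht]
  exact integral_exp_pos (h.integrable_exp ht)

/-- Markov's inequality for `1 - exp (-t * x)`, which exceeds `1 - exp (-1)` once `x > 1 / t`. -/
lemma real_Ioi_le (h : IsLSInverse f μ) {t : ℝ} (ht : 0 < t) :
    (1 - Real.exp (-1)) * μ.real (Set.Ioi (1 / t)) ≤ 1 - f t := by
  have := h.isProbabilityMeasure
  have hnn : 0 ≤ᵐ[μ] fun x => 1 - Real.exp (-t * x) := h.ae_nonneg.mono fun x hx => by
    have : Real.exp (-t * x) ≤ 1 := Real.exp_le_one_iff.2 (by nlinarith)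
    simpa using this
  have hint : Integrable (fun x => 1 - Real.exp (-t * x)) μ :=
    (integrable_const 1).sub (h.integrable_exp ht.le)
  have h1 := mul_meas_ge_le_integral_of_nonneg hnn hint (1 - Real.exp (-1))
  rw [integral_sub (integrable_const 1) (h.integrable_exp ht.le), h.laplace t ht.le] at h1
  simp only [integral_const, probReal_univ, one_smul] at h1
  refine le_trans (mul_le_mul_of_nonneg_left (measureReal_mono fun x hx => ?_) ?_) h1
  · have : 1 < x * t := (div_lt_iff₀ ht).1 hx
    have : Real.exp (-t * x) ≤ Real.exp (-1) := Real.exp_le_exp.2 (by linarith)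
    simp only [Set.mem_ofPred_eq]
    linarith
  · have : Real.exp (-1) ≤ 1 := Real.exp_le_one_iff.2 (by norm_num)
    linarith

/-- The discrete law with mass `p k` at `x k`. -/
lemma exists_discrete {p x : ℕ → ℝ} (hp : ∀ k, 0 ≤ p k) (hs : HasSum p 1) (hx : ∀ k, 0 ≤ x k) :
    ∃ μ, IsLSInverse (fun t => ∑' k, p k * Real.exp (-t * x k)) μ := by
  refine ⟨Measure.sum fun k => ENNReal.ofReal (p k) • Measure.dirac (x k), ⟨?_⟩, ?_,
    fun t ht => ?_⟩
  · rw [Measure.sum_apply _ MeasurableSet.univ]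
    simp only [Measure.smul_apply, measure_univ, smul_eq_mul, mul_one]
    rw [← ENNReal.ofReal_tsum_of_nonneg hp hs.summable, hs.tsum_eq, ENNReal.ofReal_one]
  · rw [Measure.sum_apply _ measurableSet_Iio]
    simp [Measure.dirac_apply' _ measurableSet_Iio, hx]
  · have hle : ∀ k, Real.exp (-t * x k) ≤ 1 := fun k =>
      Real.exp_le_one_iff.2 (by nlinarith [hx k])
    rw [integral_sum_measure]
    · simp [ENNReal.toReal_ofReal, hp]
    · refine integrable_sum_measure (fun k => ?_) ?_
      · exact (integrable_dirac (by simp)).smul_measure ENNReal.ofReal_ne_top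
      · simp only [integral_smul_measure, integral_dirac, ENNReal.toReal_ofReal (hp _),
          Real.norm_eq_abs, Real.abs_exp, smul_eq_mul]
        exact hs.summable.of_nonneg_of_le (fun k => mul_nonneg (hp k) (Real.exp_pos _).le)
          fun k => mul_le_of_le_one_right (hp k) (hle k)

/-- The common minorant `g` makes `1 - f n t` small uniformly in `n` for one small `t`, and
`real_Ioi_le` turns this into a uniform tail bound. -/
lemma isTightMeasureSet {f : ℕ → ℝ → ℝ} {μ : ℕ → Measure ℝ} (h : ∀ n, IsLSInverse (f n) (μ n))
    {g : ℝ → ℝ} (hg : ContinuousWithinAt g (Set.Ici 0) 0) (hg0 : g 0 = 1)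
    (hle : ∀ n t, 0 ≤ t → g t ≤ f n t) : IsTightMeasureSet (Set.range μ) := by
  rw [isTightMeasureSet_iff_exists_isCompact_measure_compl_le]
  intro ε hε
  by_cases hεt : ε = ⊤
  · exact ⟨∅, isCompact_empty, by simp [hεt]⟩
  have hε' : 0 < ε.toReal := ENNReal.toReal_pos hε.ne' hεt
  have hc : 0 < 1 - Real.exp (-1) := sub_pos.2 (Real.exp_lt_one_iff.2 (by norm_num))
  have hev : ∀ᶠ t in nhdsWithin 0 (Set.Ioi 0), 1 - (1 - Real.exp (-1)) * ε.toReal < g t := by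
    refine (hg.mono_left (nhdsWithin_mono _ Set.Ioi_subset_Ici_self)).eventually (lt_mem_nhds ?_)
    rw [hg0]
    linarith [mul_pos hc hε']
  obtain ⟨t, ht, ht0⟩ := (hev.and self_mem_nhdsWithin).exists
  have ht0 : 0 < t := ht0
  refine ⟨Set.Icc 0 (1 / t), isCompact_Icc, ?_⟩
  rintro _ ⟨n, rfl⟩
  have := (h n).isProbabilityMeasure
  have hsub : (Set.Icc 0 (1 / t))ᶜ ⊆ Set.Iio 0 ∪ Set.Ioi (1 / t) := fun x hx => by
    simp only [Set.mem_compl_iff, Set.mem_Icc, not_and_or, not_le] at hx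
    exact hx
  refine (measure_mono hsub).trans ((measure_union_le _ _).trans ?_)
  rw [(h n).nonneg, zero_add, ← ENNReal.ofReal_toReal hεt, ← ofReal_measureReal]
  refine ENNReal.ofReal_le_ofReal (le_of_mul_le_mul_left ?_ hc)
  linarith [(h n).real_Ioi_le ht0, hle n t ht0.le]

/-- A continuity theorem for Laplace transforms of laws on `[0, ∞)`. -/
lemma exists_of_tendsto {f : ℕ → ℝ → ℝ} {μ : ℕ → Measure ℝ} (h : ∀ n, IsLSInverse (f n) (μ n))
    {g : ℝ → ℝ} (hg : ContinuousWithinAt g (Set.Ici 0) 0) (hg0 : g 0 = 1)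
    (hle : ∀ n t, 0 ≤ t → g t ≤ f n t)
    (hlim : ∀ t, 0 ≤ t → Filter.Tendsto (fun n => f n t) Filter.atTop (nhds (g t))) :
    ∃ ν, IsLSInverse g ν := by
  let μ' : ℕ → ProbabilityMeasure ℝ := fun n => ⟨μ n, (h n).isProbabilityMeasure⟩
  have htight : IsTightMeasureSet {x | ∃ m ∈ Set.range μ', (m : Measure ℝ) = x} := by
    refine (isTightMeasureSet h hg hg0 hle).subset ?_
    rintro _ ⟨_, ⟨n, rfl⟩, rfl⟩
    exact ⟨n, rfl⟩
  have hcomp := isCompact_closure_of_isTightMeasureSet htight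
  -- Compactness is used along an ultrafilter finer than `atTop`, so no subsequence is extracted.
  let U : Ultrafilter ℕ := Filter.hyperfilter ℕ
  have hU : (U : Filter ℕ) ≤ Filter.atTop := Nat.hyperfilter_le_atTop
  obtain ⟨ν, -, hν⟩ := isCompact_iff_ultrafilter_le_nhds.1 hcomp (U.map μ') (by
    rw [Filter.le_principal_iff]
    exact Filter.mem_of_superset (Filter.range_mem_map) subset_closure)
  have hν : Filter.Tendsto μ' U (nhds ν) := hν
  have hneg : (ν : Measure ℝ) (Set.Iio 0) = 0 := by
    have := ProbabilityMeasure.le_liminf_measure_open_of_tendsto hν (isOpen_Iio (a := (0 : ℝ)))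
    have h0 : (fun n => (μ' n : Measure ℝ) (Set.Iio 0)) = fun _ => 0 :=
      funext fun n => (h n).nonneg
    rw [h0, Filter.liminf_const] at this
    exact le_antisymm this zero_le
  have hae : ∀ᵐ x ∂(ν : Measure ℝ), 0 ≤ x := by
    rw [ae_iff]
    simpa [Set.Iio] using hneg
  refine ⟨ν, inferInstance, hneg, fun t ht => ?_⟩
  -- Weak convergence needs a bounded test function on all of `ℝ`; truncating at `0` changes nothing
  -- for laws on `[0, ∞)`.
  let F : BoundedContinuousFunction ℝ ℝ := BoundedContinuousFunction.ofNormedAddCommGroup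
    (fun x => Real.exp (-t * max x 0)) (by fun_prop) 1 fun x => by
      rw [Real.norm_eq_abs, Real.abs_exp, Real.exp_le_one_iff]
      nlinarith [le_max_right x 0]
  have hF : ∀ (m : Measure ℝ), (∀ᵐ x ∂m, 0 ≤ x) →
      ∫ x, F x ∂m = ∫ x, Real.exp (-t * x) ∂m := fun m hm =>
    integral_congr_ae (hm.mono fun x hx => by
      simp only [F, BoundedContinuousFunction.coe_ofNormedAddCommGroup, max_eq_left hx])
  have h1 := (ProbabilityMeasure.tendsto_iff_forall_integral_tendsto.1 hν) F
  rw [hF _ hae] at h1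
  refine tendsto_nhds_unique h1 (((hlim t ht).mono_left hU).congr fun n => ?_)
  exact ((hF _ (h n).ae_nonneg).trans ((h n).laplace t ht)).symm

end IsLSInverse

/-! ### Bernstein's theorem -/

/-- At `x = a - a * exp (-t / a)` the power `(a - x) ^ k` is `a ^ k * exp (-t * (k / a))`. The
Taylor series at `a` is thus the transform of a discrete law on the points `k / a`, of total mass `f
0 = 1`. -/
lemma IsCM.exists_isLSInverse_approx {f : ℝ → ℝ} (hf : IsCM f) (hf0 : f 0 = 1) {a : ℝ}
    (ha : 0 < a) : ∃ μ, IsLSInverse (fun t => f (a - a * Real.exp (-t / a))) μ := by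
  have hs := hf.hasSum_taylor le_rfl ha
  rw [sub_zero, hf0] at hs
  obtain ⟨μ, h⟩ := IsLSInverse.exists_discrete (x := fun k => k / a)
    (fun k => mul_nonneg (hf.2.coeff_nonneg ha k) (pow_nonneg ha.le k)) hs
    fun k => by positivity
  refine ⟨μ, h.1, h.2, fun t ht => (h.laplace t ht).trans ?_⟩
  have he : Real.exp (-t / a) ≤ 1 :=
    Real.exp_le_one_iff.2 (div_nonpos_of_nonpos_of_nonneg (by linarith) ha.le)
  have hp := mul_pos ha (Real.exp_pos (-t / a))
  rw [← (hf.hasSum_taylor (a := a) (x := a - a * Real.exp (-t / a))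
    (by nlinarith) (by linarith)).tsum_eq]
  refine tsum_congr fun k => ?_
  rw [sub_sub_cancel, mul_pow, ← Real.exp_nat_mul, mul_assoc]
  congr 3
  ring

/-- **Bernstein's theorem**. -/
theorem IsCM.exists_isLSInverse {f : ℝ → ℝ} (hf : IsCM f) (hf0 : f 0 = 1) :
    ∃ μ, IsLSInverse f μ := by
  choose μ hμ using fun n : ℕ => hf.exists_isLSInverse_approx hf0 (a := n + 1) (by positivity)
  -- The upper bound `t` makes `f` itself the common minorant of the approximants.
  have hmem : ∀ (n : ℕ) (t : ℝ), 0 ≤ t → 0 ≤ (n + 1 : ℝ) - (n + 1) * Real.exp (-t / (n + 1)) ∧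
      (n + 1 : ℝ) - (n + 1) * Real.exp (-t / (n + 1)) ≤ t := by
    intro n t ht
    have hn : (0 : ℝ) < n + 1 := by positivity
    have he : Real.exp (-t / (n + 1)) ≤ 1 :=
      Real.exp_le_one_iff.2 (div_nonpos_of_nonpos_of_nonneg (by linarith) hn.le)
    have he' := Real.add_one_le_exp (-t / (n + 1))
    have : (n + 1) * (-t / (n + 1) + 1) = -t + (n + 1) := by field_simp
    constructor <;> nlinarith
  refine IsLSInverse.exists_of_tendsto hμ (hf.1 0 Set.self_mem_Ici) hf0 (fun n t ht => ?_)
    fun t ht => ?_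
  · exact hf.antitoneOn (hmem n t ht).1 ht (hmem n t ht).2
  · refine (hf.1 t ht).tendsto.comp (tendsto_nhdsWithin_iff.2 ⟨?_,
      Filter.Eventually.of_forall fun n => (hmem n t ht).1⟩)
    -- With `a = n + 1`, the argument `a - a * exp (-t / a)` is the difference quotient of `s ↦ -exp
    -- (-t * s)` at `0` with step `1 / a`.
    have hd : HasDerivAt (fun s : ℝ => -Real.exp (-t * s)) t 0 := by
      simpa using (((hasDerivAt_id (0 : ℝ)).const_mul (-t)).exp).fun_neg
    have hsl := hd.tendsto_slope_zero
    have ht0 : Filter.Tendsto (fun n : ℕ => 1 / ((n : ℝ) + 1)) Filter.atTop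
        (nhdsWithin 0 {0}ᶜ) :=
      tendsto_nhdsWithin_iff.2 ⟨tendsto_one_div_add_atTop_nhds_zero_nat,
        Filter.Eventually.of_forall fun n => by
          have : (0 : ℝ) < n + 1 := by positivity
          simpa using this.ne'⟩
    refine (hsl.comp ht0).congr fun n => ?_
    simp only [Function.comp_apply, zero_add, mul_zero, Real.exp_zero, one_div, inv_inv,
      smul_eq_mul, ← div_eq_mul_inv]
    ring

/-! ### Characteristic function of the one-sided stable law -/

/-- On the principal branch `-(t * I)` has argument `-sign t * π / 2`, so its power has argument
`-sign t * π * α / 2`. Since `α < 1`, the cosine is nonzero and can be factored out. -/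
lemma Complex.neg_mul_I_cpow {α t : ℝ} (hα : 0 < α) (hα1 : α < 1) :
    (-(t * Complex.I)) ^ (α : ℂ) =
      ((Real.cos (Real.pi * α / 2) * |t| ^ α : ℝ) : ℂ) *
        (1 - Complex.I * ((Real.sign t * Real.tan (Real.pi * α / 2) : ℝ) : ℂ)) := by
  have hpi := Real.pi_pos
  have hcos : 0 < Real.cos (Real.pi * α / 2) :=
    Real.cos_pos_of_mem_Ioo ⟨by nlinarith, by nlinarith⟩
  have hsin := Real.tan_mul_cos hcos.ne'
  have key : ∀ (s : ℝ) (w : ℂ), s = 1 ∨ s = -1 → t ≠ 0 → w ≠ 0 →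
      Complex.log w = ((-(s * (Real.pi / 2)) : ℝ) : ℂ) * Complex.I →
      (((|t| : ℝ) : ℂ) * w) ^ (α : ℂ) = ((Real.cos (Real.pi * α / 2) * |t| ^ α : ℝ) : ℂ) *
        (1 - Complex.I * ((s * Real.tan (Real.pi * α / 2) : ℝ) : ℂ)) := by
    intro s w hs ht hw hlog
    have ht' := abs_pos.2 ht
    have h1 : (Real.log |t| + ((-(s * (Real.pi / 2)) : ℝ) : ℂ) * Complex.I) * (α : ℂ) =
        ((Real.log |t| * α : ℝ) : ℂ) + ((-(s * (Real.pi * α / 2)) : ℝ) : ℂ) * Complex.I := by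
      push_cast; ring
    rw [Complex.cpow_def_of_ne_zero (mul_ne_zero (Complex.ofReal_ne_zero.2 ht'.ne') hw),
      Complex.log_ofReal_mul ht' hw, hlog, h1, Complex.exp_add, Complex.exp_mul_I,
      ← Complex.ofReal_exp, ← Complex.ofReal_cos, ← Complex.ofReal_sin,
      Real.rpow_def_of_pos ht', Real.cos_neg, Real.sin_neg]
    have hc : Real.cos (s * (Real.pi * α / 2)) = Real.cos (Real.pi * α / 2) := by
      rcases hs with rfl | rfl <;> simp
    have hsn : Real.sin (s * (Real.pi * α / 2)) =
        s * (Real.tan (Real.pi * α / 2) * Real.cos (Real.pi * α / 2)) := by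
      rw [hsin]
      rcases hs with rfl | rfl <;> simp
    rw [hc, hsn]
    push_cast
    ring
  rcases lt_trichotomy t 0 with ht | rfl | ht
  · rw [Real.sign_of_neg ht, ← key (-1) Complex.I (Or.inr rfl) ht.ne Complex.I_ne_zero
      (by rw [Complex.log_I]; push_cast; ring), abs_of_neg ht]
    push_cast
    ring_nf
  · simp [hα.ne']
  · rw [Real.sign_of_pos ht, ← key 1 (-Complex.I) (Or.inl rfl) ht.ne'
      (neg_ne_zero.2 Complex.I_ne_zero) (by rw [Complex.log_neg_I]; push_cast; ring),
      abs_of_pos ht]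
    ring_nf

open Complex in
-- Both `E exp (z X)` and `exp (-(-z) ^ α)` are analytic on `re z < 0` and agree on the negative
-- reals, hence on the half-plane. Letting `z → t * I` from the left uses dominated convergence (`X
-- ≥ 0`) on one side and, for `t ≠ 0`, distance from the branch cut on the other.
lemma IsLSInverse.charFun_eq_of_exp_neg_rpow {μ : Measure ℝ} {α : ℝ} (hα : 0 < α)
    (h : IsLSInverse (fun t => Real.exp (-t ^ α)) μ) (t : ℝ) :
    charFun μ t = cexp (-(-(t * I)) ^ (α : ℂ)) := by
  have := h.isProbabilityMeasure
  have hα' : (α : ℂ) ≠ 0 := ofReal_ne_zero.2 hα.ne'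
  rcases eq_or_ne t 0 with rfl | ht
  · simp [hα']
  have hint : ∀ z : ℂ, z.re < 0 → z.re ∈ interior (integrableExpSet id μ) := by
    intro z hz
    refine mem_interior.2 ⟨Set.Iio 0, fun x hx => ?_, isOpen_Iio, hz⟩
    have hx : x < 0 := hx
    simpa [integrableExpSet] using h.integrable_exp (t := -x) (by linarith)
  have hU : IsOpen {z : ℂ | z.re < 0} := isOpen_lt continuous_re continuous_const
  have hf : AnalyticOnNhd ℂ (complexMGF id μ) {z : ℂ | z.re < 0} := fun z hz =>
    analyticAt_complexMGF (hint z hz)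
  have hg : AnalyticOnNhd ℂ (fun z : ℂ => cexp (-(-z) ^ (α : ℂ))) {z : ℂ | z.re < 0} := by
    refine DifferentiableOn.analyticOnNhd (fun z hz => ?_) hU
    have hz : z.re < 0 := hz
    refine (DifferentiableAt.cexp (DifferentiableAt.neg
      (DifferentiableAt.cpow_const (by fun_prop) ?_))).differentiableWithinAt
    exact Or.inl (by simpa using hz)
  have heq : ∀ x : ℝ, x < 0 → complexMGF id μ x = cexp (-(-(x : ℂ)) ^ (α : ℂ)) := by
    intro x hx
    have h1 := h.laplace (-x) (by linarith)
    rw [complexMGF_ofReal, mgf]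
    simp only [neg_neg] at h1
    simp only [id_eq, h1]
    rw [← ofReal_neg, ← ofReal_cpow (by linarith)]
    push_cast
    rfl
  have hfreq : ∃ᶠ z : ℂ in nhdsWithin ((-1 : ℝ) : ℂ) {((-1 : ℝ) : ℂ)}ᶜ,
      complexMGF id μ z = cexp (-(-z) ^ (α : ℂ)) := by
    have hev : ∀ᶠ x : ℝ in nhdsWithin (-1) {-1}ᶜ,
        complexMGF id μ x = cexp (-(-(x : ℂ)) ^ (α : ℂ)) :=
      ((gt_mem_nhds (by norm_num : (-1 : ℝ) < 0)).filter_mono nhdsWithin_le_nhds).mono heq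
    have htend : Filter.Tendsto (fun x : ℝ => (x : ℂ)) (nhdsWithin (-1) {-1}ᶜ)
        (nhdsWithin ((-1 : ℝ) : ℂ) {((-1 : ℝ) : ℂ)}ᶜ) :=
      tendsto_nhdsWithin_iff.2 ⟨(continuous_ofReal.tendsto _).mono_left nhdsWithin_le_nhds,
        Filter.mem_of_superset self_mem_nhdsWithin fun x hx h =>
          hx (ofReal_injective h)⟩
    exact htend.frequently hev.frequently
  have hEqOn := hf.eqOn_of_preconnected_of_frequently_eq hg
    (convex_halfSpace_re_lt 0).isPreconnected (by simp) hfreq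
  have hpath : Filter.Tendsto (fun x : ℝ => (x : ℂ) + t * I) (nhdsWithin 0 (Set.Iio 0))
      (nhds (t * I)) :=
    (Continuous.tendsto' (by fun_prop) _ _ (by simp)).mono_left nhdsWithin_le_nhds
  have h1 : Filter.Tendsto (fun x : ℝ => complexMGF id μ (x + t * I)) (nhdsWithin 0 (Set.Iio 0))
      (nhds (complexMGF id μ (t * I))) := by
    refine tendsto_integral_filter_of_dominated_convergence (fun _ => 1)
      (Filter.Eventually.of_forall fun x => by fun_prop) ?_ (integrable_const 1)
      (Filter.Eventually.of_forall fun y => ?_)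
    · filter_upwards [self_mem_nhdsWithin] with x hx
      have hx : x < 0 := hx
      filter_upwards [h.ae_nonneg] with y hy
      rw [Complex.norm_exp]
      simp only [id_eq, Real.exp_le_one_iff]
      simp
      nlinarith
    · exact (hpath.mul_const _).cexp
  have h2 : Filter.Tendsto (fun x : ℝ => cexp (-(-((x : ℂ) + t * I)) ^ (α : ℂ)))
      (nhdsWithin 0 (Set.Iio 0)) (nhds (cexp (-(-(t * I)) ^ (α : ℂ)))) := by
    have hc : ContinuousAt (fun z : ℂ => cexp (-(-z) ^ (α : ℂ))) (t * I) := by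
      refine (ContinuousAt.neg (ContinuousAt.cpow (by fun_prop) (by fun_prop) ?_)).cexp
      exact Or.inr (by simpa using ht)
    exact hc.tendsto.comp hpath
  rw [← complexMGF_id_mul_I]
  refine tendsto_nhds_unique h1 (h2.congr' ?_)
  filter_upwards [self_mem_nhdsWithin] with x hx
  exact (hEqOn (by simpa using hx)).symm

/-! ### Completely monotone generators and their inverses -/

namespace IsGenerator

variable {ψ : ℝ → ℝ}

/-- By Bernstein's theorem `ψ` is the Laplace transform of a probability law, and such a transform
never vanishes. -/
lemma pos (hψ : IsGenerator ψ) (hc : IsCM ψ) {t : ℝ} (ht : 0 ≤ t) : 0 < ψ t := by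
  obtain ⟨μ, hμ⟩ := hc.exists_isLSInverse hψ.map_zero
  exact hμ.pos ht

lemma strictAntiOn_Ici (hψ : IsGenerator ψ) (hc : IsCM ψ) : StrictAntiOn ψ (Set.Ici 0) :=
  hψ.strictAntiOn.mono fun _ ht => ⟨ht, fun _ hu h0 => absurd h0 (hψ.pos hc hu).ne'⟩

/-- Since `-ψ'` is nonnegative and antitone, a zero of `ψ'` would persist to the right and make `ψ`
constant there, against strict monotonicity. This gives differentiability of the inverse. -/
lemma deriv_ne_zero (hψ : IsGenerator ψ) (hc : IsCM ψ) {t : ℝ} (ht : 0 < t) :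
    deriv ψ t ≠ 0 := by
  intro h0
  have hd : ∀ u, t < u → deriv ψ u = 0 := fun u hu => by
    have h1 := hc.2.neg_deriv.antitoneOn ht (ht.trans hu) hu.le
    have h2 := hc.2.neg_deriv.nonneg (ht.trans hu)
    simp only [h0] at h1
    linarith
  have hsub : Set.Icc t (t + 1) ⊆ Set.Ioi 0 := fun u hu => ht.trans_le hu.1
  have hconst : ψ (t + 1) = ψ t :=
    constant_of_derivWithin_zero (hc.2.differentiableOn.mono hsub) (fun u hu => by
      have hu0 : 0 < u := ht.trans_le hu.1
      rw [(hc.2.differentiableAt hu0).derivWithin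
        (uniqueDiffOn_Icc (by linarith : t < t + 1) u (Set.Ico_subset_Icc_self hu))]
      rcases hu.1.eq_or_lt with rfl | h
      · exact h0
      · exact hd u h) _ (Set.right_mem_Icc.2 (by linarith))
  have := hψ.strictAntiOn_Ici hc (Set.mem_Ici.2 ht.le) (Set.mem_Ici.2 (by linarith : 0 ≤ t + 1))
    (by linarith)
  linarith

lemma mem_Ioc (hψ : IsGenerator ψ) (hc : IsCM ψ) {t : ℝ} (ht : 0 ≤ t) :
    ψ t ∈ Set.Ioc (0 : ℝ) 1 := ⟨hψ.pos hc ht, (hψ.mapsTo ht).2⟩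

lemma genInv_apply (hψ : IsGenerator ψ) (hc : IsCM ψ) {t : ℝ} (ht : 0 ≤ t) :
    genInv ψ (ψ t) = t := by
  have : {u : ℝ | 0 ≤ u ∧ ψ u = ψ t} = {t} := by
    ext u
    exact ⟨fun hu => (hψ.strictAntiOn_Ici hc).injOn hu.1 ht hu.2, fun hu => by
      rw [Set.mem_singleton_iff.1 hu]; exact ⟨ht, rfl⟩⟩
  rw [genInv, this, csInf_singleton]

lemma exists_apply_eq (hψ : IsGenerator ψ) {s : ℝ} (hs : s ∈ Set.Ioc (0 : ℝ) 1) :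
    ∃ t, 0 ≤ t ∧ ψ t = s := by
  obtain ⟨T, hT, hT0⟩ := ((hψ.tendsto_zero.eventually (gt_mem_nhds hs.1)).and
    (Filter.eventually_ge_atTop 0)).exists
  obtain ⟨t, ht, hts⟩ := intermediate_value_Icc' hT0
    (hψ.continuousOn.mono Set.Icc_subset_Ici_self) ⟨hT.le, hψ.map_zero ▸ hs.2⟩
  exact ⟨t, ht.1, hts⟩

lemma genInv_nonneg {ψ : ℝ → ℝ} (s : ℝ) : 0 ≤ genInv ψ s :=
  Real.sInf_nonneg fun _ ht => ht.1

lemma apply_genInv (hψ : IsGenerator ψ) (hc : IsCM ψ) {s : ℝ} (hs : s ∈ Set.Ioc (0 : ℝ) 1) :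
    ψ (genInv ψ s) = s := by
  obtain ⟨t, ht, rfl⟩ := hψ.exists_apply_eq hs
  rw [hψ.genInv_apply hc ht]

lemma lt_genInv_iff (hψ : IsGenerator ψ) (hc : IsCM ψ) {s a : ℝ} (hs : s ∈ Set.Ioc (0 : ℝ) 1)
    (ha : 0 ≤ a) : a < genInv ψ s ↔ s < ψ a := by
  conv_rhs => rw [← hψ.apply_genInv hc hs]
  exact ((hψ.strictAntiOn_Ici hc).lt_iff_gt (genInv_nonneg s) ha).symm

lemma genInv_lt_iff (hψ : IsGenerator ψ) (hc : IsCM ψ) {s a : ℝ} (hs : s ∈ Set.Ioc (0 : ℝ) 1)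
    (ha : 0 ≤ a) : genInv ψ s < a ↔ ψ a < s := by
  conv_rhs => rw [← hψ.apply_genInv hc hs]
  exact ((hψ.strictAntiOn_Ici hc).lt_iff_gt ha (genInv_nonneg s)).symm

lemma continuousOn_genInv (hψ : IsGenerator ψ) (hc : IsCM ψ) :
    ContinuousOn (genInv ψ) (Set.Ioc 0 1) := by
  intro s hs
  refine tendsto_order.2 ⟨fun a ha => ?_, fun a ha => ?_⟩
  · rcases lt_or_ge a 0 with h | h
    · exact Filter.Eventually.of_forall fun u => h.trans_le (genInv_nonneg u)
    · have := (hψ.lt_genInv_iff hc hs h).1 ha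
      filter_upwards [self_mem_nhdsWithin, nhdsWithin_le_nhds (gt_mem_nhds this)] with u hu hu'
      exact (hψ.lt_genInv_iff hc hu h).2 hu'
  · have h := (genInv_nonneg s).trans ha.le
    have := (hψ.genInv_lt_iff hc hs h).1 ha
    filter_upwards [self_mem_nhdsWithin, nhdsWithin_le_nhds (lt_mem_nhds this)] with u hu hu'
    exact (hψ.genInv_lt_iff hc hu h).2 hu'

lemma genInv_pos (hψ : IsGenerator ψ) (hc : IsCM ψ) {s : ℝ} (hs : s ∈ Set.Ioo (0 : ℝ) 1) :
    0 < genInv ψ s :=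
  (hψ.lt_genInv_iff hc ⟨hs.1, hs.2.le⟩ le_rfl).2 (hψ.map_zero ▸ hs.2)

lemma differentiableAt_genInv (hψ : IsGenerator ψ) (hc : IsCM ψ) {s : ℝ}
    (hs : s ∈ Set.Ioo (0 : ℝ) 1) : DifferentiableAt ℝ (genInv ψ) s := by
  have hpos := hψ.genInv_pos hc hs
  have hnhds : Set.Ioo (0 : ℝ) 1 ∈ nhds s := Ioo_mem_nhds hs.1 hs.2
  refine (HasDerivAt.of_local_left_inverse
    ((hψ.continuousOn_genInv hc).continuousAt
      (Filter.mem_of_superset hnhds Set.Ioo_subset_Ioc_self))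
    (hc.2.differentiableAt hpos).hasDerivAt (hψ.deriv_ne_zero hc hpos) ?_).differentiableAt
  filter_upwards [hnhds] with u hu
  exact hψ.apply_genInv hc (Set.Ioo_subset_Ioc_self hu)

variable {φ : ℝ → ℝ}

lemma mem_Ioo (hψ : IsGenerator ψ) (hc : IsCM ψ) {t : ℝ} (ht : 0 < t) :
    ψ t ∈ Set.Ioo (0 : ℝ) 1 :=
  ⟨hψ.pos hc ht.le, hψ.map_zero ▸ hψ.strictAntiOn_Ici hc Set.self_mem_Ici
    (Set.mem_Ici.2 ht.le) ht⟩

lemma continuousOn_genInv_comp (hφ : IsGenerator φ) (hφc : IsCM φ) (hψ : IsGenerator ψ)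
    (hψc : IsCM ψ) : ContinuousOn (fun t => genInv φ (ψ t)) (Set.Ici 0) :=
  (hφ.continuousOn_genInv hφc).comp hψ.continuousOn fun _ ht => hψ.mem_Ioc hψc ht

lemma differentiableOn_genInv_comp (hφ : IsGenerator φ) (hφc : IsCM φ) (hψ : IsGenerator ψ)
    (hψc : IsCM ψ) : DifferentiableOn ℝ (fun t => genInv φ (ψ t)) (Set.Ioi 0) := fun t ht =>
  ((hφ.differentiableAt_genInv hφc (hψ.mem_Ioo hψc ht)).comp t
    (hψc.2.differentiableAt ht)).differentiableWithinAt

lemma genInv_comp_zero (hφ : IsGenerator φ) (hφc : IsCM φ) (hψ : IsGenerator ψ) :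
    genInv φ (ψ 0) = 0 := by
  rw [hψ.map_zero, ← hφ.map_zero, hφ.genInv_apply hφc le_rfl]

end IsGenerator

/-! ### The stable mixing law and the representation -/

/-- For `β > 1` the scale is chosen so that `γ ^ (1 / β)` is exactly the cosine in
`Complex.neg_mul_I_cpow`. For `β = 1` the scale is `cos (π / 2) = 0`, and the unit drift supplies
the exponent. -/
lemma stableExponent_outerPower {β : ℝ} (hβ : 1 ≤ β) (t : ℝ) :
    stableExponent (1 / β) 1 (Real.cos (Real.pi / (2 * β)) ^ β) (if β = 1 then 1 else 0) t =
      -(-(t * Complex.I)) ^ ((1 / β : ℝ) : ℂ) := by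
  rcases hβ.eq_or_lt with rfl | h
  · simp [stableExponent, mul_comm]
  have hβ0 : 0 < β := by linarith
  have hα : 0 < 1 / β := by positivity
  have hα1 : 1 / β < 1 := by rwa [div_lt_one hβ0]
  have harg : Real.pi / (2 * β) = Real.pi * (1 / β) / 2 := by field_simp
  have hcos : 0 ≤ Real.cos (Real.pi * (1 / β) / 2) := by
    have hpi := Real.pi_pos
    exact Real.cos_nonneg_of_mem_Icc ⟨by nlinarith, by nlinarith⟩
  rw [Complex.neg_mul_I_cpow hα hα1, stableExponent, if_neg hα1.ne, if_neg h.ne', harg,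
    ← Real.rpow_mul hcos, mul_one_div_cancel hβ0.ne', Real.rpow_one]
  push_cast
  ring

lemma isCM_exp_neg_comp {g : ℝ → ℝ} (hc : ContinuousOn g (Set.Ici 0))
    (hpos : ∀ t, 0 < t → 0 < g t) (hd : DifferentiableOn ℝ g (Set.Ioi 0))
    (hcm : IsCMOnPos (deriv g)) {c : ℝ} (h0 : 0 ≤ c) : IsCM fun t => Real.exp (-c * g t) :=
  ⟨(continuousOn_const.mul hc).rexp, (IsCMOnPos.exp_neg_mul h0).comp hpos hd hcm⟩

lemma exists_isLSInverse_exp_neg_rpow {α : ℝ} (h0 : 0 < α) (h1 : α ≤ 1) :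
    ∃ μ, IsLSInverse (fun t => Real.exp (-t ^ α)) μ := by
  have := isCM_exp_neg_comp (g := fun t => t ^ α)
    (fun t _ => (Real.continuousAt_rpow_const t α (Or.inr h0.le)).continuousWithinAt)
    (fun t ht => Real.rpow_pos_of_pos ht _)
    (fun t ht => (Real.differentiableAt_rpow_const_of_ne _
      (ne_of_gt ht)).differentiableWithinAt) (IsCMOnPos.deriv_rpow h0.le h1) zero_le_one
  simp only [neg_mul, one_mul] at this
  exact this.exists_isLSInverse (by simp [Real.zero_rpow h0.ne'])

lemma isOuterPowerStable_of_isLSInverse {β : ℝ} (hβ : 1 ≤ β) {μ : Measure ℝ}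
    (h : IsLSInverse (fun t => Real.exp (-t ^ (1 / β))) μ) : IsOuterPowerStable β μ := by
  have hβ0 : 0 < β := by linarith
  have hα : 0 < 1 / β := by positivity
  have hα1 : 1 / β ≤ 1 := by rwa [div_le_one hβ0]
  have hcos : 0 ≤ Real.cos (Real.pi / (2 * β)) := by
    refine Real.cos_nonneg_of_mem_Icc ⟨?_, ?_⟩
    · have : 0 < Real.pi / (2 * β) := by positivity
      linarith [Real.pi_pos]
    · exact div_le_div_of_nonneg_left Real.pi_pos.le two_pos (by linarith)
  exact ⟨⟨hα, by linarith⟩, by norm_num, Real.rpow_nonneg hcos _, h.isProbabilityMeasure,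
    fun t => by rw [h.charFun_eq_of_exp_neg_rpow hα, stableExponent_outerPower hβ]⟩

/-- A law with this transform exists by Bernstein's theorem and has the stable characteristic
function; uniqueness of characteristic functions identifies it with `μ`. -/
lemma IsOuterPowerStable.isLSInverse {β : ℝ} (hβ : 1 ≤ β) {μ : Measure ℝ}
    (h : IsOuterPowerStable β μ) : IsLSInverse (fun t => Real.exp (-t ^ (1 / β))) μ := by
  have hβ0 : 0 < β := by linarith
  obtain ⟨σ, hσ⟩ := exists_isLSInverse_exp_neg_rpow (α := 1 / β) (by positivity)
    (by rwa [div_le_one hβ0])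
  have hσ' := isOuterPowerStable_of_isLSInverse hβ hσ
  have := h.isProbabilityMeasure
  have := hσ.isProbabilityMeasure
  rwa [Measure.ext_of_charFun (μ := μ) (ν := σ) (funext fun t => by
    rw [h.charFun_eq, hσ'.charFun_eq])]

/-- A mixture of the scaled laws with Laplace transform `exp (-t ^ (1 / β))`. -/
lemma isLSInverse_mul_rpow {Ω : Type*} [MeasurableSpace Ω] {P : Measure Ω}
    [IsProbabilityMeasure P] {S V : Ω → ℝ} (hS : AEMeasurable S P) (hV : AEMeasurable V P)
    (hSV : IndepFun S V P) {β : ℝ} (hβ : 0 < β)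
    (hSl : IsLSInverse (fun t => Real.exp (-t ^ (1 / β))) (P.map S)) {f : ℝ → ℝ}
    (hVl : IsLSInverse f (P.map V)) :
    IsLSInverse (fun t => f (t ^ (1 / β))) (P.map fun ω => S ω * V ω ^ β) := by
  have hm : AEMeasurable (fun ω => S ω * V ω ^ β) P := hS.mul (hV.pow_const β)
  have hS0 : ∀ᵐ ω ∂P, 0 ≤ S ω := ae_of_ae_map hS hSl.ae_nonneg
  have hV0 : ∀ᵐ ω ∂P, 0 ≤ V ω := ae_of_ae_map hV hVl.ae_nonneg
  have := hSl.isProbabilityMeasure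
  have := hVl.isProbabilityMeasure
  refine ⟨Measure.isProbabilityMeasure_map hm, ?_, fun t ht => ?_⟩
  · rw [Measure.map_apply_of_aemeasurable hm measurableSet_Iio]
    refine measure_mono_null (fun ω hω => ?_) (ae_iff.1 (hS0.and hV0))
    intro h
    exact absurd (mul_nonneg h.1 (Real.rpow_nonneg h.2 β)) (not_le.2 hω)
  have hF : Measurable fun p : ℝ × ℝ => Real.exp (-t * (p.1 * p.2 ^ β)) := by fun_prop
  have hmap := (indepFun_iff_map_prod_eq_prod_map_map hS hV).1 hSV
  have hcomp : ∫ x, Real.exp (-t * x) ∂(P.map fun ω => S ω * V ω ^ β) =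
      ∫ p, Real.exp (-t * (p.1 * p.2 ^ β)) ∂((P.map S).prod (P.map V)) := by
    rw [integral_map hm (by fun_prop), ← hmap,
      integral_map (hS.prodMk hV) hF.aestronglyMeasurable]
  have hae : ∀ᵐ p ∂((P.map S).prod (P.map V)), 0 ≤ p.1 ∧ 0 ≤ p.2 :=
    (Measure.quasiMeasurePreserving_fst.ae hSl.ae_nonneg).and
      (Measure.quasiMeasurePreserving_snd.ae hVl.ae_nonneg)
  have hint : Integrable (fun p : ℝ × ℝ => Real.exp (-t * (p.1 * p.2 ^ β)))
      ((P.map S).prod (P.map V)) := by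
    refine Integrable.of_bound hF.aestronglyMeasurable 1 (hae.mono fun p hp => ?_)
    rw [Real.norm_eq_abs, Real.abs_exp, Real.exp_le_one_iff]
    have := mul_nonneg ht (mul_nonneg hp.1 (Real.rpow_nonneg hp.2 β))
    linarith
  rw [hcomp, integral_prod_symm _ hint, ← hVl.laplace _ (Real.rpow_nonneg ht _)]
  refine integral_congr_ae (hVl.ae_nonneg.mono fun v hv => ?_)
  -- Given `V = v`, the transform of `S` is taken at `t * v ^ β`, whose power `1 / β` is `t ^ (1 /
  -- β) * v`.
  have h1 := hSl.laplace (t * v ^ β) (mul_nonneg ht (Real.rpow_nonneg hv β))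
  rw [Real.mul_rpow ht (Real.rpow_nonneg hv β), ← Real.rpow_mul hv, mul_one_div_cancel hβ.ne',
    Real.rpow_one] at h1
  simp only [neg_mul]
  rw [← h1]
  exact integral_congr_ae (Filter.Eventually.of_forall fun s => by ring_nf)

theorem mainTheorem2
    (a₁ a₂ : CMGeneratorFamily) (θ₁ θ₂ β₁ β₂ : ℝ)
    (hθ₁ : θ₁ ∈ a₁.Θ) (hθ₂ : θ₂ ∈ a₂.Θ) (hβ₁ : β₁ = 1) (hβ₂ : 1 ≤ β₂)
    (hcm : IsCMOnPos (deriv fun t => genInv (a₁.gen θ₁) (a₂.gen θ₂ t))) :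
    -- the sufficient nesting condition for the outer power generators
    IsCMOnPos (deriv fun t => genInv (a₁.opGen θ₁ β₁) (a₂.opGen θ₂ β₂ t)) ∧
    -- the stable law of `S` exists
    (∃ σ : Measure ℝ, IsOuterPowerStable β₂ σ) ∧
    ∀ V₁ : ℝ, 0 < V₁ →
      IsCM (psi12 (a₁.opGen θ₁ β₁) (a₂.opGen θ₂ β₂) V₁) ∧
      -- the law of `V̆₁₂` exists
      (∃ ν : Measure ℝ,
        IsLSInverse (fun t => psiBar12 (a₁.gen θ₁) (a₂.gen θ₂) t ^ V₁) ν) ∧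
      -- the stochastic representation of `V₁₂`
      ∀ (Ω : Type*) [MeasurableSpace Ω] (P : Measure Ω) [IsProbabilityMeasure P] (S V : Ω → ℝ),
        AEMeasurable S P → AEMeasurable V P → IndepFun S V P →
        IsOuterPowerStable β₂ (P.map S) →
        IsLSInverse (fun t => psiBar12 (a₁.gen θ₁) (a₂.gen θ₂) t ^ V₁) (P.map V) →
        IsLSInverse (psi12 (a₁.opGen θ₁ β₁) (a₂.opGen θ₂ β₂) V₁)
          (P.map fun ω => S ω * V ω ^ β₂) := by
  subst hβ₁
  have hφ := a₁.isGenerator θ₁ hθ₁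
  have hφc := a₁.isCM θ₁ hθ₁
  have hψ := a₂.isGenerator θ₂ hθ₂
  have hψc := a₂.isCM θ₂ hθ₂
  have hβ0 : 0 < β₂ := by linarith
  have hα : 0 < 1 / β₂ := by positivity
  have hα1 : 1 / β₂ ≤ 1 := by rwa [div_le_one hβ0]
  have hcont := hφ.continuousOn_genInv_comp hφc hψ hψc
  have hdiff := hφ.differentiableOn_genInv_comp hφc hψ hψc
  have hzero := hφ.genInv_comp_zero hφc hψ
  have hpos : ∀ t, 0 < t → 0 < genInv (a₁.gen θ₁) (a₂.gen θ₂ t) := fun t ht =>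
    hφ.genInv_pos hφc (hψ.mem_Ioo hψc ht)
  have hop₁ : a₁.opGen θ₁ 1 = a₁.gen θ₁ := by
    funext t
    simp [CMGeneratorFamily.opGen, outerPower]
  have hop₂ : ∀ t, a₂.opGen θ₂ β₂ t = a₂.gen θ₂ (t ^ (1 / β₂)) := fun _ => rfl
  have hrpos : ∀ t : ℝ, 0 < t → 0 < t ^ (1 / β₂) := fun t ht => Real.rpow_pos_of_pos ht _
  have hrdiff : DifferentiableOn ℝ (fun t : ℝ => t ^ (1 / β₂)) (Set.Ioi 0) := fun t ht =>
    (Real.differentiableAt_rpow_const_of_ne _ (ne_of_gt ht)).differentiableWithinAt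
  have hrcm := IsCMOnPos.deriv_rpow hα.le hα1
  have hcm' : IsCMOnPos
      (deriv fun t => genInv (a₁.gen θ₁) (a₂.gen θ₂ (t ^ (1 / β₂)))) := by
    refine ((hcm.comp hrpos hrdiff hrcm).mul hrcm).congr fun t ht => ?_
    exact ((hdiff.differentiableAt (Ioi_mem_nhds (hrpos t ht))).hasDerivAt.comp t
      (hrdiff.differentiableAt (Ioi_mem_nhds ht)).hasDerivAt).deriv.symm
  simp only [hop₁, hop₂, psiBar12]
  refine ⟨hcm', ?_, fun V₁ hV₁ => ⟨?_, ?_, ?_⟩⟩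
  · obtain ⟨σ, hσ⟩ := exists_isLSInverse_exp_neg_rpow hα hα1
    exact ⟨σ, isOuterPowerStable_of_isLSInverse hβ₂ hσ⟩
  · exact isCM_exp_neg_comp (hcont.comp (f := fun t => t ^ (1 / β₂))
      (fun t _ => (Real.continuousAt_rpow_const t _ (Or.inr hα.le)).continuousWithinAt)
      fun t ht => Real.rpow_nonneg ht _) (fun t ht => hpos _ (hrpos t ht))
      (hdiff.comp hrdiff hrpos) hcm' hV₁.le
  · have h := isCM_exp_neg_comp hcont hpos hdiff hcm hV₁.le
    obtain ⟨ν, hν⟩ := h.exists_isLSInverse (by simp [hzero])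
    refine ⟨ν, hν.1, hν.2, fun t ht => (hν.laplace t ht).trans ?_⟩
    rw [← Real.exp_mul]
    ring_nf
  -- The mixture has transform `psiBar12 ^ V₁` at `t ^ (1 / β₂)`; pulling `V₁` into the exponential
  -- gives `psi12`.
  · intro Ω _ P _ S V hS hV hSV hSl hVl
    have h := isLSInverse_mul_rpow hS hV hSV hβ0 (hSl.isLSInverse hβ₂) hVl
    refine ⟨h.1, h.2, fun t ht => (h.laplace t ht).trans ?_⟩
    rw [psi12, hop₂, ← Real.exp_mul]
    ring_nf
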